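/- Let $n\ge 1$ and let $m_1,\dots,m_n\ge 1$ be integers, $M=m_1+\dots+m_n$. Let $U_i^{(j)}$ ($1\le i\le n$, $1\le j\le m_i$) be $M$ i.i.d. random variables, uniformly distributed on $[0,1)$, regarded as marks on the circle $\mathbb{T}=\mathbb{R}/\mathbb{Z}\cong[0,1)$ of circumference $1$, the marks $U_i^{(1)},\dots,U_i^{(m_i)}$ carrying the label $i$. Almost surely the marks are distinct; let $U_{1:M}<\dots<U_{M:M}$ be their order statistics. Start at the position $V_0=0$, and for $k=1,\dots,n$ move clockwise (in the direction of increasing coordinate, passing from $1$ to $0$ if necessary) from $V_{k-1}$ to the first mark with label $k$ that is encountered; let $V_k$ be the position of this mark, let $X_k=\min_{1\le j\le m_k}\{U_k^{(j)}-V_{k-1}\}$ be the length of the clockwise arc from $V_{k-1}$ to $V_k$ (where $\{x\}=x-\lfloor x\rfloor$), and let $I_k\in\{1,\dots,M\}$ be the index with $V_k=U_{I_k:M}$. (a) (Bernoulli clock.) Suppose $m_1=\dots=m_n=2$, so that $M=2n$. Then $X_1,\dots,X_n$ are i.i.d. with the beta$(1,2)$ distribution, which has density $2(1-x)$ on $(0,1)$,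 and the random sequence $(I_1,\dots,I_n)$ is independent of the sequence of order statistics $(U_{1:2n},\dots,U_{2n:2n})$. (b) (Generalized Bernoulli clock.) For arbitrary $m_1,\dots,m_n\ge1$, the random variables $X_1,\dots,X_n$ are independent, $X_i$ has the beta$(1,m_i)$ distribution, with density $m_i(1-x)^{m_i-1}$ on $(0,1)$, for each $1\le i\le n$, and the random sequence $(I_1,\dots,I_n)$ is independent of the sequence of order statistics $(U_{1:M},\dots,U_{M:M})$. -/

import Mathlib

open MeasureTheory ProbabilityTheory

noncomputable section

namespace BernoulliClock

/-- The length of the clockwise arc from `x` to `y` on the circle `ℝ / ℤ` of circumference `1`,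
as a number in `[0, 1)`. -/
def arc (x y : ℝ) : ℝ := Int.fract (y - x)

/-- Among the marks `v j`, the number `j` of the one encountered first when moving clockwise from
`x`: the first entry after sorting the marks by their clockwise distance from `x`. -/
def firstHit {a : ℕ} (ha : 0 < a) (x : ℝ) (v : Fin a → ℝ) : Fin a :=
  Tuple.sort (fun j => arc x (v j)) ⟨0, ha⟩

variable {n : ℕ} {m : Fin n → ℕ}

/-- The position on the clock after the first `k` stops. The marks with label `i` are the
`u ⟨i, j⟩`, `j : Fin (m i)`. The walk starts at `0`; its next stop is the first mark with the next
label which is met when moving clockwise from the current position. (After all `n` labels have been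
visited the position stays where it is.) -/
def position (hm : ∀ i, 0 < m i) (u : (Σ i : Fin n, Fin (m i)) → ℝ) : ℕ → ℝ
  | 0 => 0
  | k + 1 =>
    if h : k < n then
      u ⟨⟨k, h⟩, firstHit (hm ⟨k, h⟩) (position hm u k) (fun j => u ⟨⟨k, h⟩, j⟩)⟩
    else position hm u k

/-- The mark at which the walk stops for the label `k`. -/
def stopMark (hm : ∀ i, 0 < m i) (u : (Σ i : Fin n, Fin (m i)) → ℝ) (k : Fin n) :
    Σ i : Fin n, Fin (m i) :=
  ⟨k, firstHit (hm k) (position hm u k) (fun j => u ⟨k, j⟩)⟩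

/-- The clockwise spacing between the previous stop (the origin, for the first label) and the stop
for the label `k`. Labels are numbered from `0`. -/
def spacing (hm : ∀ i, 0 < m i) (u : (Σ i : Fin n, Fin (m i)) → ℝ) (k : Fin n) : ℝ :=
  arc (position hm u k) (position hm u (k + 1))

/-- All the marks, listed as a tuple of length `M = m_1 + ... + m_n`. -/
def marks (u : (Σ i : Fin n, Fin (m i)) → ℝ) (r : Fin (∑ i, m i)) : ℝ :=
  u (finSigmaFinEquiv.symm r)

/-- The order statistics of the marks: the marks rearranged in increasing order, numbered
from `0`. -/
def orderStat (u : (Σ i : Fin n, Fin (m i)) → ℝ) (r : Fin (∑ i, m i)) : ℝ :=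
  marks u (Tuple.sort (marks u) r)

/-- The index in the list of order statistics (numbered from `0`) of the mark at which the walk
stops for the label `k`. -/
def index (hm : ∀ i, 0 < m i) (u : (Σ i : Fin n, Fin (m i)) → ℝ) (k : Fin n) :
    Fin (∑ i, m i) :=
  (Tuple.sort (marks u)).symm (finSigmaFinEquiv (stopMark hm u k))

/-- The marks of the clock with exactly two marks `a i`, `b i` for each label `i`. -/
def pairMarks (a b : Fin n → ℝ) : (Σ _ : Fin n, Fin 2) → ℝ :=
  fun p => ![a p.1, b p.1] p.2

theorem arc_firstHit_le {a : ℕ} (ha : 0 < a) (x : ℝ) (v : Fin a → ℝ) (j : Fin a) :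
    arc x (v (firstHit ha x v)) ≤ arc x (v j) := by
  have h := Tuple.monotone_sort (fun j => arc x (v j))
    (show (⟨0, ha⟩ : Fin a) ≤ (Tuple.sort (fun j => arc x (v j))).symm j from Nat.zero_le _)
  simpa [firstHit] using h

theorem position_succ (hm : ∀ i, 0 < m i) (u : (Σ i : Fin n, Fin (m i)) → ℝ) (k : Fin n) :
    position hm u (k + 1) = u (stopMark hm u k) := by
  simp [position, stopMark]

theorem orderStat_index (hm : ∀ i, 0 < m i) (u : (Σ i : Fin n, Fin (m i)) → ℝ) (k : Fin n) :
    orderStat u (index hm u k) = position hm u (k + 1) := by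
  simp [position_succ, orderStat, index, marks]

end BernoulliClock

end

namespace BernoulliClock

/-! Spacings: rotating the circle preserves the uniform law. Hence, given the marks of the earlier
labels, the arcs from the current position to the `m k` marks of label `k` are i.i.d. uniform,
wherever that position is. Their minimum is at least `t ∈ [0, 1]` with probability `(1 - t) ^ m k`,
which is the beta(1, `m k`) tail and does not involve the past. Induction over the labels gives the
product law (`map_minArc`, `measure_spacing_lt`).

Indices: the walk sees only the relative order of the marks (`stopMark_congr`), so almost surely the
indices are a function of the sorting permutation. By exchangeability that permutation is
independent of the order statistics (`indepFun_tupleSort_sorted`). -/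

/-! ### Rotation invariance and the beta(1, a) law -/

theorem measurable_arc (x : ℝ) : Measurable (arc x) :=
  measurable_fract.comp (measurable_id.sub_const x)

/-- `arc x` is 1-periodic, so `[0, 1)` may be exchanged for `[x, x + 1)`, where `arc x` is
translation by `-x`. -/
theorem measurePreserving_arc (x : ℝ) :
    MeasurePreserving (arc x) (volume.restrict (Set.Ico (0 : ℝ) 1))
      (volume.restrict (Set.Ico (0 : ℝ) 1)) := by
  refine ⟨measurable_arc x, Measure.ext fun A hA => ?_⟩
  have hB : MeasurableSet (arc x ⁻¹' A) := measurable_arc x hA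
  rw [Measure.map_apply (measurable_arc x) hA, Measure.restrict_apply hB,
    Measure.restrict_apply hA]
  have h1 : volume (arc x ⁻¹' A ∩ Set.Ico 0 1) = volume (arc x ⁻¹' A ∩ Set.Ioc 0 (0 + 1)) := by
    rw [zero_add]
    exact measure_congr ((Filter.EventuallyEq.refl _ _).inter Ico_ae_eq_Ioc)
  have h2 : volume (arc x ⁻¹' A ∩ Set.Ioc x (x + 1)) =
      volume (arc x ⁻¹' A ∩ Set.Ico x (x + 1)) :=
    measure_congr ((Filter.EventuallyEq.refl _ _).inter Ico_ae_eq_Ioc.symm)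
  have h3 : volume (arc x ⁻¹' A ∩ Set.Ioc 0 (0 + 1)) =
      volume (arc x ⁻¹' A ∩ Set.Ioc x (x + 1)) := by
    refine (isAddFundamentalDomain_Ioc one_pos 0).measure_set_eq
      (isAddFundamentalDomain_Ioc one_pos x) hB ?_
    rintro ⟨g, hg⟩
    obtain ⟨z, rfl⟩ := AddSubgroup.mem_zmultiples_iff.1 hg
    ext u
    simp only [Set.mem_preimage, arc, AddSubgroup.mk_vadd, vadd_eq_add, zsmul_eq_mul, mul_one]
    rw [add_sub_assoc, Int.fract_intCast_add]
  rw [h1, h3, h2, ← measure_preimage_add volume x]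
  congr 1
  ext u
  simp only [Set.mem_preimage, Set.mem_inter_iff, Set.mem_Ico, arc, add_sub_cancel_left]
  constructor
  · rintro ⟨h, h4, h5⟩
    have h6 : u ∈ Set.Ico (0 : ℝ) 1 := ⟨by linarith, by linarith⟩
    rw [Int.fract_eq_self.2 h6] at h
    exact ⟨h, h6⟩
  · rintro ⟨h, h6⟩
    rw [Int.fract_eq_self.2 h6]
    exact ⟨h, by linarith [h6.1], by linarith [h6.2]⟩

theorem measure_le_arc (x t : ℝ) (h0 : 0 ≤ t) :
    volume.restrict (Set.Ico (0 : ℝ) 1) {u | t ≤ arc x u} = ENNReal.ofReal (1 - t) := by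
  have h := (measurePreserving_arc x).measure_preimage
    (measurableSet_Ici (a := t)).nullMeasurableSet
  rw [Measure.restrict_apply measurableSet_Ici] at h
  have h' : Set.Ici t ∩ Set.Ico 0 1 = Set.Ico t 1 := by
    ext u
    simp only [Set.mem_inter_iff, Set.mem_Ici, Set.mem_Ico]
    grind
  rw [h', Real.volume_Ico] at h
  exact h

theorem beta_one_natCast {a : ℕ} (ha : 0 < a) : beta 1 a = 1 / a := by
  have h : (a : ℝ) ≠ 0 := by positivity
  have hg : Real.Gamma a ≠ 0 := (Real.Gamma_pos_of_pos (by positivity)).ne'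
  rw [beta, Real.Gamma_one, add_comm, Real.Gamma_add_one h]
  field_simp

theorem betaMeasure_one_Ici {a : ℕ} (ha : 0 < a) {t : ℝ} (h0 : 0 ≤ t) :
    betaMeasure 1 a (Set.Ici t) = ENNReal.ofReal (1 - t) ^ a := by
  rw [betaMeasure, withDensity_apply _ measurableSet_Ici]
  have h1 : ∫⁻ x in Set.Ici t, betaPDF 1 a x =
      ∫⁻ x in Set.Ioc t 1, ENNReal.ofReal (a * (1 - x) ^ (a - 1)) := by
    -- Null endpoints are dropped because the explicit density is available only for `0 < x < 1`.
    rw [setLIntegral_congr Ioi_ae_eq_Ici.symm, setLIntegral_congr Ioo_ae_eq_Ioc.symm,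
      ← lintegral_indicator measurableSet_Ioi, ← lintegral_indicator measurableSet_Ioo]
    refine lintegral_congr fun x => ?_
    by_cases hx : x ∈ Set.Ioo t 1
    · rw [Set.indicator_of_mem hx, Set.indicator_of_mem (show x ∈ Set.Ioi t from hx.1),
        betaPDF_of_pos_lt_one (h0.trans_lt hx.1) hx.2, beta_one_natCast ha]
      congr 1
      rw [← Real.rpow_natCast, Nat.cast_sub (Nat.one_le_iff_ne_zero.2 ha.ne')]
      simp
    · rw [Set.indicator_of_notMem hx]
      by_cases hx' : x ∈ Set.Ioi t
      · rw [Set.indicator_of_mem hx', betaPDF_eq_zero_of_one_le]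
        by_contra! h
        exact hx ⟨hx', h⟩
      · rw [Set.indicator_of_notMem hx']
  rw [h1]
  rcases le_total 1 t with h | h
  · rw [Set.Ioc_eq_empty (by simpa using h), ENNReal.ofReal_of_nonpos (by linarith)]
    simp [ha.ne']
  · rw [← ofReal_integral_eq_lintegral_ofReal, ← intervalIntegral.integral_of_le h,
      ← ENNReal.ofReal_pow (by linarith)]
    · congr 1
      rw [intervalIntegral.integral_const_mul,
        intervalIntegral.integral_comp_sub_left (fun x => x ^ (a - 1)) 1, integral_pow,
        Nat.cast_sub (Nat.one_le_iff_ne_zero.2 ha.ne'), Nat.sub_add_cancel ha]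
      have h : (a : ℝ) ≠ 0 := by positivity
      simp [ha.ne']
      field_simp
    · exact (Continuous.integrableOn_Icc (by fun_prop)).mono_set Set.Ioc_subset_Icc_self
    · refine ae_restrict_of_forall_mem measurableSet_Ioc fun x hx => ?_
      have : 0 ≤ 1 - x := by linarith [hx.2]
      simp only [Pi.zero_apply]
      positivity

theorem arc_nonneg (x y : ℝ) : 0 ≤ arc x y := Int.fract_nonneg _

instance : IsProbabilityMeasure (volume.restrict (Set.Ico (0 : ℝ) 1)) := ⟨by simp⟩

theorem betaMeasure_eq_map {α : Type*} [MeasurableSpace α] {a : ℕ} (ha : 0 < a)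
    (ν : Measure α) [IsProbabilityMeasure ν] (f : α → ℝ) (hf : Measurable f) (h0 : ∀ x, 0 ≤ f x)
    (h : ∀ t, 0 ≤ t → ν {x | t ≤ f x} = ENNReal.ofReal (1 - t) ^ a) :
    ν.map f = betaMeasure 1 a := by
  have := isProbabilityMeasureBeta (α := 1) (β := a) one_pos (by positivity)
  have := Measure.isProbabilityMeasure_map (μ := ν) hf.aemeasurable
  refine Measure.ext_of_Ici _ _ fun t => ?_
  rcases le_total 0 t with ht | ht
  · rw [betaMeasure_one_Ici ha ht, Measure.map_apply hf measurableSet_Ici, ← h t ht]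
    rfl
  · have h1 : betaMeasure 1 a (Set.Ici t) = 1 := by
      refine le_antisymm prob_le_one ?_
      have h2 := betaMeasure_one_Ici ha le_rfl
      rw [sub_zero, ENNReal.ofReal_one, one_pow] at h2
      exact h2 ▸ measure_mono (Set.Ici_subset_Ici.2 ht)
    rw [h1, Measure.map_apply hf measurableSet_Ici,
      Set.eq_univ_of_forall (s := f ⁻¹' Set.Ici t) fun x => ht.trans (h0 x), measure_univ]

/-! ### Measurability of sorting, of the nearest mark and of the walk -/

/-- Each fibre is cut out by finitely many comparisons of coordinates: sortedness, and ties kept in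
their original order. -/
theorem measurable_tupleSort {a : ℕ} :
    Measurable[_, ⊤] (fun v : Fin a → ℝ => Tuple.sort v) := by
  let : MeasurableSpace (Equiv.Perm (Fin a)) := ⊤
  refine measurable_to_countable' fun σ => ?_
  have : (fun v : Fin a → ℝ => Tuple.sort v) ⁻¹' {σ} =
      {v | (∀ i j, i ≤ j → v (σ i) ≤ v (σ j)) ∧
        ∀ i j, i < j → v (σ i) = v (σ j) → σ i < σ j} := by
    ext v
    simp only [Set.mem_preimage, Set.mem_singleton_iff, Set.mem_ofPred_eq]
    rw [eq_comm, Tuple.eq_sort_iff]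
    rfl
  rw [this]
  simp only [Set.ofPred_and, Set.ofPred_forall]
  refine MeasurableSet.inter ?_ ?_
  · exact .iInter fun i => .iInter fun j => .iInter fun _ =>
      measurableSet_le (measurable_pi_apply _) (measurable_pi_apply _)
  · refine .iInter fun i => .iInter fun j => .iInter fun _ => ?_
    by_cases h : σ i < σ j
    · simp [h]
    · simp only [h, imp_false]
      have h' : MeasurableSet {v : Fin a → ℝ | v (σ i) = v (σ j)} :=
        measurableSet_eq_fun (measurable_pi_apply _) (measurable_pi_apply _)
      exact h'.compl

theorem measurable_eval_index {α ι : Type*} [MeasurableSpace α] [Countable ι]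
    [MeasurableSpace ι] [MeasurableSingletonClass ι] {f : α → ι → ℝ} {g : α → ι}
    (hf : Measurable f) (hg : Measurable g) : Measurable fun x => f x (g x) := by
  have h : Measurable fun q : (ι → ℝ) × ι => q.1 q.2 :=
    measurable_from_prod_countable_left fun i => (measurable_pi_apply i : Measurable fun q : ι → ℝ => q i)
  exact h.comp (hf.prodMk hg)

theorem measurable_firstHit {α : Type*} [MeasurableSpace α] {a : ℕ} (ha : 0 < a)
    {x : α → ℝ} {v : α → Fin a → ℝ} (hx : Measurable x) (hv : Measurable v) :
    Measurable fun q => firstHit ha (x q) (v q) := by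
  have h1 : Measurable fun q j => arc (x q) (v q j) :=
    measurable_pi_lambda _ fun j =>
      measurable_fract.comp (((measurable_pi_apply j).comp hv).sub hx)
  let : MeasurableSpace (Equiv.Perm (Fin a)) := ⊤
  have h2 : Measurable fun σ : Equiv.Perm (Fin a) => σ ⟨0, ha⟩ := measurable_from_top
  exact h2.comp (measurable_tupleSort.comp h1)

/-- The clockwise distance from `x` to the nearest of the marks `v j`. -/
noncomputable def minArc {a : ℕ} (ha : 0 < a) (x : ℝ) (v : Fin a → ℝ) : ℝ :=
  arc x (v (firstHit ha x v))

theorem le_minArc_iff {a : ℕ} (ha : 0 < a) (x : ℝ) (v : Fin a → ℝ) (t : ℝ) :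
    t ≤ minArc ha x v ↔ ∀ j, t ≤ arc x (v j) :=
  ⟨fun h j => h.trans (arc_firstHit_le ha x v j), fun h => h _⟩

theorem measurable_minArc {α : Type*} [MeasurableSpace α] {a : ℕ} (ha : 0 < a)
    {x : α → ℝ} {v : α → Fin a → ℝ} (hx : Measurable x) (hv : Measurable v) :
    Measurable fun q => minArc ha (x q) (v q) :=
  measurable_fract.comp ((measurable_eval_index hv (measurable_firstHit ha hx hv)).sub hx)

/-- The event that all arcs are at least `t` is a product event, whose probability is free of `x`.
-/
theorem map_minArc {a : ℕ} (ha : 0 < a) (x : ℝ) :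
    (Measure.pi fun _ : Fin a => volume.restrict (Set.Ico (0 : ℝ) 1)).map (minArc ha x) =
      betaMeasure 1 a := by
  refine betaMeasure_eq_map ha _ _ (measurable_minArc ha measurable_const measurable_id)
    (fun v => arc_nonneg _ _) fun t ht => ?_
  have : {v : Fin a → ℝ | t ≤ minArc ha x v} = Set.univ.pi fun _ => {u | t ≤ arc x u} := by
    ext v
    simp [le_minArc_iff]
  rw [this, Measure.pi_pi]
  simp [measure_le_arc x t ht]

variable {n : ℕ} {m : Fin n → ℕ}

theorem position_congr (hm : ∀ i, 0 < m i) {u v : (Σ i : Fin n, Fin (m i)) → ℝ} (k : ℕ)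
    (h : ∀ p : Σ i : Fin n, Fin (m i), (p.1 : ℕ) < k → u p = v p) :
    position hm u k = position hm v k := by
  induction k with
  | zero => rfl
  | succ k ih =>
    have ih := ih fun p hp => h p (hp.trans k.lt_succ_self)
    have h' : ∀ hk : k < n, (fun j => u ⟨⟨k, hk⟩, j⟩) = fun j => v ⟨⟨k, hk⟩, j⟩ :=
      fun hk => funext fun j => h _ k.lt_succ_self
    simp only [position, ih, h']
    split_ifs with hk
    · exact h _ k.lt_succ_self
    · rfl

theorem spacing_congr (hm : ∀ i, 0 < m i) {u v : (Σ i : Fin n, Fin (m i)) → ℝ} (k : Fin n)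
    (h : ∀ p : Σ i : Fin n, Fin (m i), p.1 ≤ k → u p = v p) :
    spacing hm u k = spacing hm v k := by
  rw [spacing, spacing, position_congr hm k fun p hp => h p (le_of_lt hp),
    position_congr hm (k + 1) fun p hp => h p (Nat.lt_succ_iff.1 hp)]

theorem spacing_eq_minArc (hm : ∀ i, 0 < m i) (u : (Σ i : Fin n, Fin (m i)) → ℝ) (k : Fin n) :
    spacing hm u k = minArc (hm k) (position hm u k) fun j => u ⟨k, j⟩ := by
  rw [spacing, position_succ]
  rfl

theorem measurable_block (k : Fin n) :
    Measurable fun (u : (Σ i : Fin n, Fin (m i)) → ℝ) (j : Fin (m k)) => u ⟨k, j⟩ :=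
  measurable_pi_lambda _ fun _ => measurable_pi_apply _

theorem measurable_position (hm : ∀ i, 0 < m i) (k : ℕ) :
    Measurable fun u : (Σ i : Fin n, Fin (m i)) → ℝ => position hm u k := by
  induction k with
  | zero => exact measurable_const
  | succ k ih =>
    by_cases hk : k < n
    · simp only [position, hk, dite_true]
      exact measurable_eval_index (f := fun u j => u ⟨⟨k, hk⟩, j⟩) (measurable_block ⟨k, hk⟩)
        (measurable_firstHit (hm ⟨k, hk⟩) ih (measurable_block ⟨k, hk⟩))
    · simpa only [position, hk, dite_false] using ih

theorem measurable_spacing (hm : ∀ i, 0 < m i) (k : Fin n) :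
    Measurable fun u : (Σ i : Fin n, Fin (m i)) → ℝ => spacing hm u k :=
  measurable_fract.comp ((measurable_position hm _).sub (measurable_position hm _))

theorem measurable_marks :
    Measurable (marks : ((Σ i : Fin n, Fin (m i)) → ℝ) → Fin (∑ i, m i) → ℝ) :=
  measurable_pi_lambda _ fun _ => measurable_pi_apply _

theorem measurable_sorted {a : ℕ} :
    Measurable fun (v : Fin a → ℝ) (r : Fin a) => v (Tuple.sort v r) := by
  let : MeasurableSpace (Equiv.Perm (Fin a)) := ⊤
  refine measurable_pi_lambda _ fun r => measurable_eval_index measurable_id ?_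
  have h : Measurable fun σ : Equiv.Perm (Fin a) => σ r := measurable_from_top
  exact h.comp measurable_tupleSort

theorem measurable_orderStat :
    Measurable fun (u : (Σ i : Fin n, Fin (m i)) → ℝ) r => orderStat u r :=
  measurable_sorted.comp measurable_marks

theorem measurable_index (hm : ∀ i, 0 < m i) :
    Measurable fun (u : (Σ i : Fin n, Fin (m i)) → ℝ) k => index hm u k := by
  let : MeasurableSpace (Equiv.Perm (Fin (∑ i, m i))) := ⊤
  refine measurable_pi_lambda _ fun k => ?_
  have h1 : Measurable fun u : (Σ i : Fin n, Fin (m i)) → ℝ =>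
      firstHit (hm k) (position hm u k) fun j => u ⟨k, j⟩ :=
    measurable_firstHit (hm k) (measurable_position hm k) (measurable_block k)
  have h2 : Measurable fun q : Equiv.Perm (Fin (∑ i, m i)) × Fin (m k) =>
      q.1.symm (finSigmaFinEquiv ⟨k, q.2⟩) := measurable_of_countable _
  exact h2.comp ((measurable_tupleSort.comp measurable_marks).prodMk h1)

/-! ### Joint law of the spacings -/

/-- Fubini: if all sections of `G` have the same probability, `G` decouples from every event about
`X`. -/
theorem measure_inter_of_indepFun {Ω α β : Type*} [MeasurableSpace Ω] [MeasurableSpace α]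
    [MeasurableSpace β] {μ : Measure Ω} [IsProbabilityMeasure μ] {X : Ω → α} {Y : Ω → β}
    (hXY : IndepFun X Y μ) (hX : Measurable X) (hY : Measurable Y) {E : Set α}
    (hE : MeasurableSet E) {G : Set (α × β)} (hG : MeasurableSet G) {c : ENNReal}
    (h : ∀ x, μ.map Y {y | (x, y) ∈ G} = c) :
    μ (X ⁻¹' E ∩ {ω | (X ω, Y ω) ∈ G}) = μ (X ⁻¹' E) * c := by
  have := Measure.isProbabilityMeasure_map (μ := μ) hX.aemeasurable
  have := Measure.isProbabilityMeasure_map (μ := μ) hY.aemeasurable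
  have hS : MeasurableSet (Prod.fst ⁻¹' E ∩ G) := (measurable_fst hE).inter hG
  have h1 : X ⁻¹' E ∩ {ω | (X ω, Y ω) ∈ G} =
      (fun ω => (X ω, Y ω)) ⁻¹' (Prod.fst ⁻¹' E ∩ G) := rfl
  rw [h1, ← Measure.map_apply (hX.prodMk hY) hS,
    (indepFun_iff_map_prod_eq_prod_map_map hX.aemeasurable hY.aemeasurable).1 hXY,
    Measure.prod_apply hS, ← Measure.map_apply hX hE]
  have h2 : ∀ x, μ.map Y (Prod.mk x ⁻¹' (Prod.fst ⁻¹' E ∩ G)) = E.indicator (fun _ => c) x := by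
    intro x
    by_cases hx : x ∈ E
    · rw [Set.indicator_of_mem hx, ← h x]
      congr 1
      ext y
      simp [hx]
    · rw [Set.indicator_of_notMem hx]
      convert measure_empty (μ := μ.map Y)
      ext y
      simp [hx]
  simp_rw [h2]
  rw [lintegral_indicator hE, setLIntegral_const, mul_comm]

/-- The law of the configuration of marks: independent and uniform on `[0, 1)`. -/
noncomputable abbrev unif (ι : Type*) [Fintype ι] : Measure (ι → ℝ) :=
  Measure.pi fun _ => volume.restrict (Set.Ico (0 : ℝ) 1)

theorem iIndepFun_eval_unif (ι : Type*) [Fintype ι] :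
    iIndepFun (fun (i : ι) (u : ι → ℝ) => u i) (unif ι) :=
  iIndepFun_pi (X := fun _ => id) fun _ => aemeasurable_id

theorem map_comp_unif {ι κ : Type*} [Fintype ι] [Fintype κ] (f : κ → ι)
    (hf : Function.Injective f) : (unif ι).map (fun u j => u (f j)) = unif κ := by
  have h := (iIndepFun_eval_unif ι).precomp hf
  rw [iIndepFun_iff_map_fun_eq_pi_map fun _ => (measurable_pi_apply _).aemeasurable] at h
  refine h.trans ?_
  congr 1
  ext1 j
  exact (measurePreserving_eval _ (f j)).map_eq

/-- The marks with labels before the `k`-th one, the others being replaced by `0`. -/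
def past (k : ℕ) (u : (Σ i : Fin n, Fin (m i)) → ℝ) (p : Σ i : Fin n, Fin (m i)) : ℝ :=
  if (p.1 : ℕ) < k then u p else 0

theorem measurable_past (k : ℕ) :
    Measurable (past k : ((Σ i : Fin n, Fin (m i)) → ℝ) → _) := by
  refine measurable_pi_lambda _ fun p => ?_
  unfold past
  split_ifs
  · exact measurable_pi_apply p
  · exact measurable_const

theorem indepFun_past_block (k : Fin n) :
    IndepFun (past k) (fun (u : (Σ i : Fin n, Fin (m i)) → ℝ) (j : Fin (m k)) => u ⟨k, j⟩)
      (unif _) := by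
  classical
  have h := (iIndepFun_eval_unif (Σ i : Fin n, Fin (m i))).indepFun_finset
    (Finset.univ.filter fun p => p.1 < k) (Finset.univ.filter fun p => p.1 = k)
    (Finset.disjoint_filter.2 fun p _ h h' => h.ne h') fun _ => measurable_pi_apply _
  let φ (v : (Finset.univ.filter fun p : Σ i : Fin n, Fin (m i) => p.1 < k) → ℝ)
    (p : Σ i : Fin n, Fin (m i)) : ℝ :=
    if hp : p.1 < k then v ⟨p, by simpa using hp⟩ else 0
  let ψ (v : (Finset.univ.filter fun p : Σ i : Fin n, Fin (m i) => p.1 = k) → ℝ)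
    (j : Fin (m k)) : ℝ := v ⟨⟨k, j⟩, by simp⟩
  have hφ : Measurable φ := by
    refine measurable_pi_lambda _ fun p => ?_
    by_cases hp : p.1 < k
    · simpa only [φ, hp, dite_true] using measurable_pi_apply _
    · simpa only [φ, hp, dite_false] using measurable_const
  have hψ : Measurable ψ := measurable_pi_lambda _ fun j => measurable_pi_apply _
  exact h.comp hφ hψ

theorem measure_spacing_lt (hm : ∀ i, 0 < m i) {A : Fin n → Set ℝ}
    (hA : ∀ k, MeasurableSet (A k)) (K : ℕ) (hK : K ≤ n) :
    unif (Σ i : Fin n, Fin (m i)) {u | ∀ k : Fin n, (k : ℕ) < K → spacing hm u k ∈ A k} =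
      ∏ k ∈ Finset.univ.filter (fun k : Fin n => (k : ℕ) < K), betaMeasure 1 (m k) (A k) := by
  induction K with
  | zero => simp
  | succ K ih =>
    obtain ⟨k, rfl⟩ : ∃ k : Fin n, (k : ℕ) = K := ⟨⟨K, hK⟩, rfl⟩
    have h1 : (Finset.univ.filter fun i : Fin n => (i : ℕ) < k + 1) =
        insert k (Finset.univ.filter fun i : Fin n => (i : ℕ) < k) := by
      ext i
      simp only [Finset.mem_filter_univ, Finset.mem_insert, Fin.ext_iff]
      omega
    rw [h1, Finset.prod_insert (by simp), mul_comm, ← ih (by omega)]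
    let E : Set ((Σ i : Fin n, Fin (m i)) → ℝ) :=
      {u | ∀ i : Fin n, (i : ℕ) < k → spacing hm u i ∈ A i}
    have hE : MeasurableSet E := by
      simp only [E, Set.ofPred_forall]
      exact .iInter fun i => .iInter fun _ => measurable_spacing hm i (hA i)
    -- Earlier spacings ignore the marks that `past k` erases.
    have hpast : past k ⁻¹' E = E := by
      ext u
      refine forall_congr' fun i => imp_congr_right fun hi => ?_
      rw [spacing_congr hm i fun p hp => ?_]
      simp [past, (Fin.le_def.1 hp).trans_lt hi]
    let G : Set (((Σ i : Fin n, Fin (m i)) → ℝ) × (Fin (m k) → ℝ)) :=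
      {q | minArc (hm k) (position hm q.1 k) q.2 ∈ A k}
    have hG : MeasurableSet G :=
      measurable_minArc (hm k) ((measurable_position hm k).comp measurable_fst) measurable_snd
        (hA k)
    -- With the past frozen at `x`, the starting position is a constant and `map_minArc` applies to
    -- the fresh block.
    have key := measure_inter_of_indepFun (indepFun_past_block k) (measurable_past k)
      (measurable_block k) hE hG (c := betaMeasure 1 (m k) (A k)) fun x => by
        rw [map_comp_unif (fun j => (⟨k, j⟩ : Σ i : Fin n, Fin (m i)))
            (fun j j' h => by simpa using h),
          ← map_minArc (hm k) (position hm x k),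
          Measure.map_apply (f := minArc (hm k) (position hm x k))
            (measurable_minArc (hm k) measurable_const measurable_id) (hA k)]
        rfl
    rw [hpast] at key
    rw [← key]
    congr 1
    ext u
    have h2 : position hm (past k u) k = position hm u k :=
      position_congr hm k fun p hp => by simp [past, hp]
    simp only [Set.mem_ofPred_eq, Set.mem_inter_iff, E, G, h2, ← spacing_eq_minArc]
    constructor
    · exact fun h => ⟨fun i hi => h i (by omega), h k (by omega)⟩
    · rintro ⟨h, h'⟩ i hi
      rcases (Nat.lt_succ_iff.1 hi).lt_or_eq with hi | hi
      · exact h i hi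
      · rwa [Fin.ext hi]

theorem hasLaw_spacing (hm : ∀ i, 0 < m i) :
    HasLaw (fun (u : (Σ i : Fin n, Fin (m i)) → ℝ) k => spacing hm u k)
      (Measure.pi fun k => betaMeasure 1 (m k)) (unif _) where
  aemeasurable := (measurable_pi_lambda _ (measurable_spacing hm)).aemeasurable
  map_eq := by
    have (k : Fin n) : IsProbabilityMeasure (betaMeasure 1 (m k)) :=
      isProbabilityMeasureBeta one_pos (by exact_mod_cast hm k)
    refine (Measure.pi_eq fun A hA => ?_).symm
    rw [Measure.map_apply (measurable_pi_lambda _ (measurable_spacing hm)) (.univ_pi hA)]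
    have := measure_spacing_lt hm hA n le_rfl
    simp only [Fin.is_lt, true_imp_iff, Finset.filter_true] at this
    rw [← this]
    congr 1
    ext u
    simp

/-! ### Ranking permutation and order statistics -/

theorem ae_injective_unif (ι : Type*) [Fintype ι] : ∀ᵐ v ∂unif ι, Function.Injective v := by
  have hle : unif ι ≤ volume := by
    rw [unif, ← Measure.restrict_pi_pi]
    exact Measure.restrict_le_self
  have h : ∀ i j : ι, i ≠ j → ∀ᵐ v ∂unif ι, v i ≠ v j := by
    intro i j hij
    -- A tie lies in a proper subspace, which is Lebesgue-null.
    let W : Submodule ℝ (ι → ℝ) :=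
      LinearMap.ker (LinearMap.proj (R := ℝ) (φ := fun _ : ι => ℝ) i - LinearMap.proj j)
    have hW : W ≠ ⊤ := by
      classical
      intro h
      have : Pi.single i (1 : ℝ) ∈ W := h ▸ Submodule.mem_top
      simp [W, hij.symm] at this
    have h0 := le_antisymm ((hle W).trans_eq (Measure.addHaar_submodule volume W hW)) zero_le
    rw [ae_iff]
    convert h0 using 2
    ext v
    simp [W, sub_eq_zero]
  filter_upwards [ae_all_iff.2 fun i => ae_all_iff.2 fun j => ae_all_iff.2 fun hij => h i j hij]
    with v hv i j hij
  by_contra hne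
  exact hv i j hne hij

theorem ae_mem_Ico_unif (ι : Type*) [Fintype ι] :
    ∀ᵐ v ∂unif ι, ∀ i, v i ∈ Set.Ico (0 : ℝ) 1 := by
  rw [unif, ← Measure.restrict_pi_pi]
  filter_upwards [ae_restrict_mem (MeasurableSet.univ_pi fun _ => measurableSet_Ico)] with v hv i
  exact hv i trivial

theorem tupleSort_eq_iff_strictMono {a : ℕ} {v : Fin a → ℝ} (hv : Function.Injective v)
    (σ : Equiv.Perm (Fin a)) : Tuple.sort v = σ ↔ StrictMono (v ∘ σ) := by
  rw [eq_comm, Tuple.eq_sort_iff]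
  constructor
  · exact fun h => h.1.strictMono_of_injective (hv.comp σ.injective)
  · exact fun h => ⟨h.monotone, fun i j hij he => absurd he (h hij).ne⟩

/-- Exchangeability: permuting coordinates by `σ` preserves the law, so the mass does not depend on
`σ`. Ties are discarded as null. -/
theorem measure_tupleSort_eq {a : ℕ} (σ : Equiv.Perm (Fin a)) {A : Set (Fin a → ℝ)}
    (hA : MeasurableSet A) :
    unif (Fin a) ({v | Tuple.sort v = σ} ∩ {v | (fun r => v (Tuple.sort v r)) ∈ A}) =
      unif (Fin a) {v | StrictMono v ∧ v ∈ A} := by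
  have hS : MeasurableSet {v : Fin a → ℝ | StrictMono v ∧ v ∈ A} := by
    have : {v : Fin a → ℝ | StrictMono v} = ⋂ i, ⋂ j, ⋂ _ : i < j, {v | v i < v j} := by
      ext v
      simp [StrictMono]
    refine MeasurableSet.inter (s₁ := {v : Fin a → ℝ | StrictMono v}) ?_ hA
    rw [this]
    exact .iInter fun i => .iInter fun j => .iInter fun _ =>
      measurableSet_lt (measurable_pi_apply _) (measurable_pi_apply _)
  have hT : Measurable fun (v : Fin a → ℝ) r => v (σ r) :=
    measurable_pi_lambda _ fun _ => measurable_pi_apply _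
  conv_rhs => rw [← map_comp_unif σ σ.injective, Measure.map_apply hT hS]
  refine measure_congr ?_
  filter_upwards [ae_injective_unif (Fin a)] with v hv
  refine propext ?_
  change Tuple.sort v = σ ∧ _ ∈ A ↔ StrictMono (v ∘ σ) ∧ v ∘ σ ∈ A
  rw [← tupleSort_eq_iff_strictMono hv]
  constructor
  · rintro ⟨rfl, h⟩
    exact ⟨rfl, h⟩
  · rintro ⟨rfl, h⟩
    exact ⟨rfl, h⟩

/-- Functions of the ranking permutation of independent uniform variables are independent of their
order statistics. -/
theorem indepFun_tupleSort_sorted {a : ℕ} {β : Type*} [MeasurableSpace β]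
    (F : Equiv.Perm (Fin a) → β) :
    IndepFun (fun v : Fin a → ℝ => F (Tuple.sort v))
      (fun (v : Fin a → ℝ) r => v (Tuple.sort v r)) (unif (Fin a)) := by
  classical
  let : MeasurableSpace (Equiv.Perm (Fin a)) := ⊤
  have key (s : Set (Equiv.Perm (Fin a))) {A : Set (Fin a → ℝ)} (hA : MeasurableSet A) :
      unif (Fin a) ((fun v => Tuple.sort v) ⁻¹' s ∩
        (fun (v : Fin a → ℝ) r => v (Tuple.sort v r)) ⁻¹' A) =
      s.toFinset.card * unif (Fin a) {v | StrictMono v ∧ v ∈ A} := by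
    have hm (s : Set (Equiv.Perm (Fin a))) :
        MeasurableSet ((fun v : Fin a → ℝ => Tuple.sort v) ⁻¹' s) :=
      measurable_tupleSort trivial
    have h := sum_measure_preimage_singleton
      (μ := (unif (Fin a)).restrict ((fun (v : Fin a → ℝ) r => v (Tuple.sort v r)) ⁻¹' A))
      s.toFinset (f := fun v => Tuple.sort v) fun σ _ => hm {σ}
    rw [Set.coe_toFinset, Measure.restrict_apply (hm s)] at h
    rw [← h, ← nsmul_eq_mul]
    refine Finset.sum_eq_card_nsmul fun σ _ => ?_
    rw [Measure.restrict_apply (hm _)]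
    exact measure_tupleSort_eq σ hA
  rw [indepFun_iff_measure_inter_preimage_eq_mul]
  intro s A _ hA
  -- These instances give both marginals; `h3` is the normalisation, number of permutations times
  -- the mass of increasing tuples equals 1.
  have h1 := key Set.univ hA
  have h2 := key (F ⁻¹' s) MeasurableSet.univ
  have h3 := key Set.univ MeasurableSet.univ
  simp only [Set.preimage_univ, Set.univ_inter, Set.inter_univ, measure_univ] at h1 h2 h3
  have h4 : (fun v : Fin a → ℝ => F (Tuple.sort v)) ⁻¹' s =
      (fun v => Tuple.sort v) ⁻¹' (F ⁻¹' s) := rfl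
  rw [h4, key _ hA, h1, h2]
  rw [mul_assoc, ← mul_assoc (unif (Fin a) _), mul_comm (unif (Fin a) _) (Finset.card _ : ENNReal),
    ← h3, one_mul]

/-! ### The walk as a function of the ranks -/

theorem tupleSort_congr {a : ℕ} {v w : Fin a → ℝ} (h : ∀ i j, v i ≤ v j ↔ w i ≤ w j) :
    Tuple.sort v = Tuple.sort w := by
  obtain ⟨h1, h2⟩ := Tuple.eq_sort_iff.1 (rfl : Tuple.sort v = Tuple.sort v)
  refine Tuple.eq_sort_iff.2 ⟨fun i j hij => (h _ _).1 (h1 hij), fun i j hij he => h2 i j hij ?_⟩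
  exact le_antisymm ((h _ _).2 he.le) ((h _ _).2 he.ge)

theorem arc_of_mem_Ico {x y : ℝ} (hx : x ∈ Set.Ico (0 : ℝ) 1) (hy : y ∈ Set.Ico (0 : ℝ) 1) :
    arc x y = if x ≤ y then y - x else y - x + 1 := by
  obtain ⟨hx0, hx1⟩ := hx
  obtain ⟨hy0, hy1⟩ := hy
  split_ifs with h
  · exact Int.fract_eq_self.2 ⟨by linarith, by linarith⟩
  · rw [arc, ← Int.fract_add_one]
    exact Int.fract_eq_self.2 ⟨by linarith, by linarith⟩

/-- Cyclic order seen from `x` reduces to linear comparisons, which any order-equivalent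
configuration shares. -/
theorem arc_le_arc_iff {x y z : ℝ} (hx : x ∈ Set.Ico (0 : ℝ) 1) (hy : y ∈ Set.Ico (0 : ℝ) 1)
    (hz : z ∈ Set.Ico (0 : ℝ) 1) :
    arc x y ≤ arc x z ↔ (x ≤ y ∧ (z < x ∨ y ≤ z)) ∨ (y < x ∧ z < x ∧ y ≤ z) := by
  obtain ⟨hx0, hx1⟩ := id hx
  obtain ⟨hy0, hy1⟩ := id hy
  obtain ⟨hz0, hz1⟩ := id hz
  rw [arc_of_mem_Ico hx hy, arc_of_mem_Ico hx hz]
  split_ifs <;> grind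

/-- The walk only depends on the relative order of the marks. -/
theorem stopMark_congr (hm : ∀ i, 0 < m i) {u v : (Σ i : Fin n, Fin (m i)) → ℝ}
    (hu : ∀ p, u p ∈ Set.Ico (0 : ℝ) 1) (hv : ∀ p, v p ∈ Set.Ico (0 : ℝ) 1)
    (h : ∀ p q, u p ≤ u q ↔ v p ≤ v q) (k : Fin n) : stopMark hm u k = stopMark hm v k := by
  have hlt : ∀ p q, u p < u q ↔ v p < v q := fun p q => by
    rw [← not_le, ← not_le, h]
  have step (k : Fin n) (hk : (position hm u k = 0 ∧ position hm v k = 0) ∨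
      ∃ p, position hm u k = u p ∧ position hm v k = v p) :
      stopMark hm u k = stopMark hm v k := by
    unfold stopMark firstHit
    congr 2
    refine tupleSort_congr fun i j => ?_
    -- The origin need not be a mark, but it lies weakly below every mark in both configurations.
    rcases hk with ⟨h1, h2⟩ | ⟨p, h1, h2⟩
    · have h0 : (0 : ℝ) ∈ Set.Ico (0 : ℝ) 1 := by simp
      rw [h1, h2, arc_le_arc_iff h0 (hu _) (hu _), arc_le_arc_iff h0 (hv _) (hv _)]
      simp only [(hu _).1, (hv _).1, (hu _).1.not_gt, (hv _).1.not_gt, h]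
    · rw [h1, h2, arc_le_arc_iff (hu _) (hu _) (hu _), arc_le_arc_iff (hv _) (hv _) (hv _)]
      simp only [h, hlt]
  suffices ∀ K : ℕ, (position hm u K = 0 ∧ position hm v K = 0) ∨
      ∃ p, position hm u K = u p ∧ position hm v K = v p from step k (this k)
  intro K
  induction K with
  | zero => exact .inl ⟨rfl, rfl⟩
  | succ K ih =>
    by_cases hK : K < n
    · refine .inr ⟨stopMark hm u ⟨K, hK⟩, position_succ hm u ⟨K, hK⟩, ?_⟩
      rw [step ⟨K, hK⟩ ih]
      exact position_succ hm v ⟨K, hK⟩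
    · simpa only [position, hK, dite_false] using ih

/-- The configuration in which the marks are equally spaced and sorted by `σ`. -/
noncomputable def rankMarks (σ : Equiv.Perm (Fin (∑ i, m i))) (p : Σ i : Fin n, Fin (m i)) : ℝ :=
  (σ.symm (finSigmaFinEquiv p) : ℕ) / (∑ i, m i : ℕ)

/-- Without ties, the marks and their ranks are ordered alike, so the right side involves `u` only
through its sorting permutation. -/
theorem index_eq_of_injective (hm : ∀ i, 0 < m i) {u : (Σ i : Fin n, Fin (m i)) → ℝ}
    (hu : ∀ p, u p ∈ Set.Ico (0 : ℝ) 1) (hinj : Function.Injective u) (k : Fin n) :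
    index hm u k = (Tuple.sort (marks u)).symm
      (finSigmaFinEquiv (stopMark hm (rankMarks (Tuple.sort (marks u))) k)) := by
  have hinj' : Function.Injective (marks u) := hinj.comp finSigmaFinEquiv.symm.injective
  have hmono := (tupleSort_eq_iff_strictMono hinj' _).1 rfl
  have hpos (p : Σ i : Fin n, Fin (m i)) : (0 : ℝ) < (∑ i, m i : ℕ) := by
    exact_mod_cast (Nat.zero_le _).trans_lt (finSigmaFinEquiv p).is_lt
  rw [index, stopMark_congr hm hu (v := rankMarks (Tuple.sort (marks u)))]
  · intro p
    refine ⟨by unfold rankMarks; positivity, ?_⟩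
    rw [rankMarks, div_lt_one (hpos p)]
    exact_mod_cast Fin.is_lt _
  · intro p q
    rw [rankMarks, rankMarks, div_le_div_iff_of_pos_right (hpos p), Nat.cast_le, Fin.val_fin_le,
      ← hmono.le_iff_le]
    simp [marks]

/-! ### Transfer to an arbitrary probability space -/

theorem indepFun_comp_of_hasLaw {Ω α β γ : Type*} [MeasurableSpace Ω] [MeasurableSpace α]
    [MeasurableSpace β] [MeasurableSpace γ] {P : Measure Ω} {μ : Measure α} {T : Ω → α}
    (hT : HasLaw T μ P) {f : α → β} {g : α → γ} (hf : Measurable f) (hg : Measurable g)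
    (h : IndepFun f g μ) : IndepFun (fun ω => f (T ω)) (fun ω => g (T ω)) P := by
  rw [indepFun_iff_measure_inter_preimage_eq_mul] at h ⊢
  intro s t hs ht
  have h := h s t hs ht
  rw [← hT.map_eq, Measure.map_apply_of_aemeasurable hT.aemeasurable ((hf hs).inter (hg ht)),
    Measure.map_apply_of_aemeasurable hT.aemeasurable (hf hs),
    Measure.map_apply_of_aemeasurable hT.aemeasurable (hg ht)] at h
  exact h

theorem indepFun_index_orderStat (hm : ∀ i, 0 < m i) :
    IndepFun (fun (u : (Σ i : Fin n, Fin (m i)) → ℝ) k => index hm u k)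
      (fun u r => orderStat u r) (unif _) := by
  let F (σ : Equiv.Perm (Fin (∑ i, m i))) (k : Fin n) : Fin (∑ i, m i) :=
    σ.symm (finSigmaFinEquiv (stopMark hm (rankMarks σ) k))
  let : MeasurableSpace (Equiv.Perm (Fin (∑ i, m i))) := ⊤
  have hF : Measurable F := measurable_from_top
  have hlaw : HasLaw marks (unif (Fin (∑ i, m i))) (unif (Σ i : Fin n, Fin (m i))) :=
    ⟨measurable_marks.aemeasurable, map_comp_unif _ finSigmaFinEquiv.symm.injective⟩
  have h2 := indepFun_comp_of_hasLaw hlaw (hF.comp measurable_tupleSort) measurable_sorted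
    (indepFun_tupleSort_sorted F)
  refine h2.congr ?_ (Filter.EventuallyEq.refl _ _)
  filter_upwards [ae_injective_unif (Σ i : Fin n, Fin (m i)), ae_mem_Ico_unif _] with u hu hu'
  exact funext fun k => (index_eq_of_injective hm hu' hu k).symm

theorem generalizedClock {Ω : Type*} [MeasurableSpace Ω] (P : Measure Ω) [IsProbabilityMeasure P]
    (hm : ∀ i, 0 < m i) (U : (Σ i : Fin n, Fin (m i)) → Ω → ℝ) (hU : iIndepFun U P)
    (hlaw : ∀ p, HasLaw (U p) (volume.restrict (Set.Ico (0 : ℝ) 1)) P) :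
    (iIndepFun (fun (k : Fin n) ω => spacing hm (fun p => U p ω) k) P ∧
        ∀ k : Fin n, HasLaw (fun ω => spacing hm (fun p => U p ω) k)
          (betaMeasure 1 (m k)) P) ∧
      IndepFun (fun ω (k : Fin n) => index hm (fun p => U p ω) k)
        (fun ω r => orderStat (fun p => U p ω) r) P := by
  have hT : HasLaw (fun ω p => U p ω) (unif _) P := hU.hasLaw_pi hlaw
  have (k : Fin n) : IsProbabilityMeasure (betaMeasure 1 (m k)) :=
    isProbabilityMeasureBeta one_pos (by exact_mod_cast hm k)
  have hX : HasLaw (fun ω k => spacing hm (fun p => U p ω) k)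
      (Measure.pi fun k => betaMeasure 1 (m k)) P := (hasLaw_spacing hm).comp hT
  have hXk (k : Fin n) : HasLaw (fun ω => spacing hm (fun p => U p ω) k)
      (betaMeasure 1 (m k)) P :=
    (measurePreserving_eval (fun k => betaMeasure 1 (m k)) k).comp_hasLaw hX
  exact ⟨⟨(iIndepFun_iff_hasLaw_pi_pi hXk).2 hX, hXk⟩,
    indepFun_comp_of_hasLaw hT (measurable_index hm) measurable_orderStat
      (indepFun_index_orderStat hm)⟩

theorem pairMarks_eq {Ω : Type*} (U U' : Fin n → Ω → ℝ) (ω : Ω) :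
    pairMarks (fun i => U i ω) (fun i => U' i ω) =
      fun p => Sum.elim U U' (if p.2 = 0 then .inl p.1 else .inr p.1) ω := by
  funext ⟨i, j⟩
  fin_cases j <;> simp [pairMarks]

end BernoulliClock

theorem mainTheorem4 {Ω : Type*} [MeasurableSpace Ω] (P : Measure Ω) [IsProbabilityMeasure P]
    (n : ℕ) (hn : 1 ≤ n) :
    -- the Bernoulli clock, with two marks for each label
    (∀ U U' : Fin n → Ω → ℝ,
      iIndepFun (Sum.elim U U') P →
      (∀ i, HasLaw (U i) (volume.restrict (Set.Ico (0 : ℝ) 1)) P) →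
      (∀ i, HasLaw (U' i) (volume.restrict (Set.Ico (0 : ℝ) 1)) P) →
      (iIndepFun (fun (k : Fin n) ω =>
          BernoulliClock.spacing (fun _ => Nat.two_pos)
          (BernoulliClock.pairMarks (fun i => U i ω) (fun i => U' i ω)) k) P ∧
        ∀ k : Fin n, HasLaw (fun ω =>
          BernoulliClock.spacing (fun _ => Nat.two_pos)
          (BernoulliClock.pairMarks (fun i => U i ω) (fun i => U' i ω)) k) (betaMeasure 1 2) P) ∧
      IndepFun
        (fun ω (k : Fin n) => BernoulliClock.index (fun _ => Nat.two_pos)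
          (BernoulliClock.pairMarks (fun i => U i ω) (fun i => U' i ω)) k)
        (fun ω r => BernoulliClock.orderStat
          (BernoulliClock.pairMarks (fun i => U i ω) (fun i => U' i ω)) r) P) ∧
    -- the generalized clock, with `m i` marks for the label `i`
    (∀ (m : Fin n → ℕ) (hm : ∀ i, 0 < m i) (U : (Σ i : Fin n, Fin (m i)) → Ω → ℝ),
      iIndepFun U P →
      (∀ p, HasLaw (U p) (volume.restrict (Set.Ico (0 : ℝ) 1)) P) →
      (iIndepFun (fun (k : Fin n) ω => BernoulliClock.spacing hm (fun p => U p ω) k) P ∧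
        ∀ k : Fin n, HasLaw (fun ω => BernoulliClock.spacing hm (fun p => U p ω) k)
          (betaMeasure 1 (m k)) P) ∧
      IndepFun
        (fun ω (k : Fin n) => BernoulliClock.index hm (fun p => U p ω) k)
        (fun ω r => BernoulliClock.orderStat (fun p => U p ω) r) P) := by
  refine ⟨fun U U' hind hU hU' => ?_, fun m hm U hU hlaw =>
    BernoulliClock.generalizedClock P hm U hU hlaw⟩
  -- Reindexing along this injection turns the two families into one clock with `m = 2`.
  let f (p : Σ _ : Fin n, Fin 2) : Fin n ⊕ Fin n := if p.2 = 0 then .inl p.1 else .inr p.1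
  have hf : Function.Injective f := by
    rintro ⟨i, j⟩ ⟨i', j'⟩ h
    fin_cases j <;> fin_cases j' <;> simp_all [f]
  have h := BernoulliClock.generalizedClock (m := fun _ => 2) P (fun _ => Nat.two_pos)
    (fun p => Sum.elim U U' (f p)) (hind.precomp hf) (fun p => by
      rcases f p with i | i
      · exact hU i
      · exact hU' i)
  simp only [BernoulliClock.pairMarks_eq]
  rw [Nat.cast_ofNat] at h
  exact h
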